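/- Let $G\rightrightarrows M$ be a source-simply-connected Lie groupoid with source and target maps $s,t$, multiplication $m$ and unit map $\epsilon:M\to G$, and let $A=\ker(ds)|_M$ be the vector bundle underlying its Lie algebroid. Let $k\ge 0$ and let $\omega$ be a closed differential $(k+1)$-form on $G$ which is multiplicative, i.e. $m^*\omega=\mathrm{pr}_1^*\omega+\mathrm{pr}_2^*\omega$ on the manifold $\{(g,h)\in G\times G: s(g)=t(h)\}$ of composable pairs. Let $\mu:A\to\wedge^kT^*M$ be the corresponding infinitesimally multiplicative (IM) form, i.e. the vector-bundle map determined by $$\mu_x(u)(X_1,\dots,X_k)=\omega_{\epsilon(x)}\big(u,\,d\epsilon(X_1),\dots,d\epsilon(X_k)\big),\qquad x\in M,\ u\in A_x,\ X_1,\dots,X_k\in T_xM .$$ Then $\omega$ is nondegenerate (that is, for every $g\in G$ and $X\in T_gG$, $i_X\omega=0$ implies $X=0$; equivalently, since $\omega$ is closed, $\omega$ is multisymplectic) if and only if the following two conditions hold: 1. $\mu$ is injective, i.e. $\ker\mu_x=\{0\}$ for every $x\in M$; 2. the annihilator of the image of $\mu$ is zero, i.e. for every $x\in M$, $\{X\in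 T_xM : i_X\mu_x(u)=0 \text{ for all } u\in A_x\}=\{0\}$. (When $k=0$, the contraction of a vector with a $0$-form is $0$ by convention.) -/

import Mathlib

open scoped Manifold ContDiff

noncomputable section

/-- The interior product `i_X η = η(X, ·, …, ·)`, with the convention `i_X η = 0` in degree `0`. -/
def interiorProduct {V : Type*} [AddCommGroup V] [Module ℝ V] [TopologicalSpace V] :
    {r : ℕ} → V → V [⋀^Fin r]→L[ℝ] ℝ → V [⋀^Fin (r - 1)]→L[ℝ] ℝ
  | 0, _, _ => 0
  | r + 1, X, η =>
    { toFun := fun v : Fin r → V => η (Matrix.vecCons X v)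
      map_update_add' := fun v i x y =>
        MultilinearMap.map_update_add (η.toAlternatingMap.curryLeft X).toMultilinearMap v i x y
      map_update_smul' := fun v i c x =>
        MultilinearMap.map_update_smul (η.toAlternatingMap.curryLeft X).toMultilinearMap v i c x
      cont := η.cont.comp (continuous_const.matrixVecCons continuous_id)
      map_eq_zero_of_eq' := fun v _ _ h hij =>
        (η.toAlternatingMap.curryLeft X).map_eq_zero_of_eq v h hij }

section DifferentialForms

variable {E : Type*} [NormedAddCommGroup E] [NormedSpace ℝ E]
  {N : Type*} [TopologicalSpace N] [ChartedSpace E N]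

/-- The expression, in the chart around `p₀`, of a field `η` of alternating `r`-forms on the tangent
spaces of `N`: the pullback of `η` along the inverse of the chart. It is meaningful on the target
of the chart. -/
def chartExpression {r : ℕ} (η : ∀ p : N, TangentSpace 𝓘(ℝ, E) p [⋀^Fin r]→L[ℝ] ℝ) (p₀ : N)
    (y : E) : E [⋀^Fin r]→L[ℝ] ℝ :=
  (η ((extChartAt 𝓘(ℝ, E) p₀).symm y)).compContinuousLinearMap
    (mfderiv 𝓘(ℝ, E) 𝓘(ℝ, E) (extChartAt 𝓘(ℝ, E) p₀).symm y :
      E →L[ℝ] TangentSpace 𝓘(ℝ, E) ((extChartAt 𝓘(ℝ, E) p₀).symm y))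

variable (E N) in
/-- Smooth differential `r`-forms on the manifold `N` (modelled on `E`). -/
structure DifferentialForm (r : ℕ) where
  /-- the value of the form at each point -/
  toFun : ∀ p : N, TangentSpace 𝓘(ℝ, E) p [⋀^Fin r]→L[ℝ] ℝ
  smooth : ∀ p₀ : N,
    ContDiffOn ℝ ∞ (chartExpression toFun p₀) (extChartAt 𝓘(ℝ, E) p₀).target

namespace DifferentialForm

variable {r : ℕ} (Ω : DifferentialForm E N r)

/-- `dΩ = 0`, the exterior derivative being computed in charts. -/
def IsClosed : Prop :=
  ∀ p₀ : N, ∀ y ∈ (extChartAt 𝓘(ℝ, E) p₀).target, extDeriv (chartExpression Ω.toFun p₀) y = 0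

/-- `Ω` is nondegenerate: the bundle map `X ↦ i_X Ω` is injective. -/
def IsNondegenerate : Prop :=
  ∀ (p : N) (X : TangentSpace 𝓘(ℝ, E) p), interiorProduct X (Ω.toFun p) = 0 → X = 0

end DifferentialForm

end DifferentialForms

/-- A Lie groupoid with manifold of arrows `G` (modelled on `E`) and manifold of units `M`
(modelled on `F`). The multiplication is a total function whose values matter only on composable
pairs. -/
structure LieGroupoid (E F G M : Type*)
    [NormedAddCommGroup E] [NormedSpace ℝ E] [NormedAddCommGroup F] [NormedSpace ℝ F]
    [TopologicalSpace G] [ChartedSpace E G] [TopologicalSpace M] [ChartedSpace F M] where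
  source : G → M
  target : G → M
  /-- the product `g h`, defined when `source g = target h` -/
  mul : G → G → G
  unit : M → G
  inv : G → G
  source_unit : ∀ x, source (unit x) = x
  target_unit : ∀ x, target (unit x) = x
  source_mul : ∀ g h, source g = target h → source (mul g h) = source h
  target_mul : ∀ g h, source g = target h → target (mul g h) = target g
  mul_assoc : ∀ g h k, source g = target h → source h = target k →
    mul (mul g h) k = mul g (mul h k)
  unit_mul : ∀ g, mul (unit (target g)) g = g
  mul_unit : ∀ g, mul g (unit (source g)) = g
  source_inv : ∀ g, source (inv g) = target g
  target_inv : ∀ g, target (inv g) = source g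
  mul_inv : ∀ g, mul g (inv g) = unit (target g)
  inv_mul : ∀ g, mul (inv g) g = unit (source g)
  source_submersion : Manifold.IsSubmersion 𝓘(ℝ, E) 𝓘(ℝ, F) ∞ source
  smooth_source : ContMDiff 𝓘(ℝ, E) 𝓘(ℝ, F) ∞ source
  smooth_target : ContMDiff 𝓘(ℝ, E) 𝓘(ℝ, F) ∞ target
  smooth_unit : ContMDiff 𝓘(ℝ, F) 𝓘(ℝ, E) ∞ unit
  smooth_inv : ContMDiff 𝓘(ℝ, E) 𝓘(ℝ, E) ∞ inv
  /-- Smoothness on the embedded submanifold of composable pairs of `G × G`. -/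
  smooth_mul : ContMDiffOn (𝓘(ℝ, E).prod 𝓘(ℝ, E)) 𝓘(ℝ, E) ∞
    (fun p : G × G => mul p.1 p.2) {p : G × G | source p.1 = target p.2}

namespace LieGroupoid

variable {E F G M : Type*}
  [NormedAddCommGroup E] [NormedSpace ℝ E] [NormedAddCommGroup F] [NormedSpace ℝ F]
  [TopologicalSpace G] [ChartedSpace E G] [TopologicalSpace M] [ChartedSpace F M]
  (𝒢 : LieGroupoid E F G M)

/-- All source fibres are (connected and) simply connected. -/
def IsSourceSimplyConnected : Prop :=
  ∀ x : M, SimplyConnectedSpace {g : G // 𝒢.source g = x}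

/-- The space of composable pairs of arrows. -/
def composable : Set (G × G) := {p | 𝒢.source p.1 = 𝒢.target p.2}

/-- The differential `dm` of the multiplication at a composable pair `(g, h)`. It is meaningful on
tangent vectors `(X, Y)` to the space of composable pairs, that is, when `ds(X) = dt(Y)`. -/
def dMul (g h : G) (X : TangentSpace 𝓘(ℝ, E) g) (Y : TangentSpace 𝓘(ℝ, E) h) :
    TangentSpace 𝓘(ℝ, E) (𝒢.mul g h) :=
  mfderivWithin (𝓘(ℝ, E).prod 𝓘(ℝ, E)) 𝓘(ℝ, E) (fun p : G × G => 𝒢.mul p.1 p.2)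
    𝒢.composable (g, h) (X, Y)

/-- The form `Ω` is multiplicative: `m^* Ω = pr₁^* Ω + pr₂^* Ω` on the space of composable pairs. -/
def IsMultiplicative {r : ℕ} (Ω : DifferentialForm E G r) : Prop :=
  ∀ g h : G, 𝒢.source g = 𝒢.target h →
    ∀ (X : Fin r → TangentSpace 𝓘(ℝ, E) g) (Y : Fin r → TangentSpace 𝓘(ℝ, E) h),
      (∀ i, (mfderiv 𝓘(ℝ, E) 𝓘(ℝ, F) 𝒢.source g (X i) : F) =
        (mfderiv 𝓘(ℝ, E) 𝓘(ℝ, F) 𝒢.target h (Y i) : F)) →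
      Ω.toFun (𝒢.mul g h) (fun i => 𝒢.dMul g h (X i) (Y i)) = Ω.toFun g X + Ω.toFun h Y

/-- The fibre at `x` of the Lie algebroid `A = ker(ds)|_M`. -/
def algebroidFiber (x : M) : Submodule ℝ (TangentSpace 𝓘(ℝ, E) (𝒢.unit x)) :=
  LinearMap.ker (mfderiv 𝓘(ℝ, E) 𝓘(ℝ, F) 𝒢.source (𝒢.unit x)).toLinearMap

/-- The IM form `μ : A → ⋀ᵏ T^*M` of a multiplicative `(k+1)`-form `Ω`, at the point `x`:
`μ(u)(X₁, …, X_k) = Ω(u, X₁, …, X_k)` for `u ∈ A_x` and `X₁, …, X_k ∈ T_x M`, where `T_x M` is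
viewed in the tangent space of `G` at the unit of `x` through the differential of the unit map. -/
def imForm {k : ℕ} (Ω : DifferentialForm E G (k + 1)) (x : M) :
    𝒢.algebroidFiber x →ₗ[ℝ] TangentSpace 𝓘(ℝ, F) x [⋀^Fin k]→L[ℝ] ℝ where
  toFun u := (interiorProduct (u : TangentSpace 𝓘(ℝ, E) (𝒢.unit x))
    (Ω.toFun (𝒢.unit x))).compContinuousLinearMap
      (mfderiv 𝓘(ℝ, F) 𝓘(ℝ, E) 𝒢.unit x)
  map_add' u v := by
    ext X
    exact (Ω.toFun (𝒢.unit x)).toAlternatingMap.map_vecCons_add _ _ _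
  map_smul' c u := by
    ext X
    exact (Ω.toFun (𝒢.unit x)).toAlternatingMap.map_vecCons_smul _ _ _

end LieGroupoid

end

/-! Work in the tangent groupoid `TG ⇉ TM`, where multiplicativity reads `ω(X·Y) = ω(X) + ω(Y)` on
tuples of composable vectors. Two consequences carry everything. Units are idempotent, so `ω`
vanishes on tuples of vectors tangent to `M` (`formAt_unit_eq_zero`). Writing the right translate of
`u ∈ A` as `u·0` and any other vector as `dε(dt w)·w` gives `i_Z ω = t^*μ(u)`
(`formAt_rightTranslate`, `formAt_unit`).

If `ω` is nondegenerate, `μ(u) = 0` forces `i_u ω = 0`, so `u = 0`. If `X` annihilates the image of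
`μ`, then `i_{dε X} ω` vanishes on `T_xM` and as soon as one argument lies in `A_x`; these span the
tangent space at the unit, so `X = 0`.

Conversely, let `i_X ω = 0` at `g`. Pairing `X` with right translates of `A` puts `dt X` in the
annihilator, so `dt X = 0` and `X` left-translates to some `v` at a unit. The `A`-component of `v`
is killed by `μ`, so `v` is tangent to `M`; then `dt v = 0` gives `v = 0`, hence `X = 0`. -/

noncomputable section

open Filter Topology

/-! ### Velocities of curves and the local form of submersions -/

section Velocity

variable {E : Type*} [NormedAddCommGroup E] [NormedSpace ℝ E]
  {N : Type*} [TopologicalSpace N] [ChartedSpace E N]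
  {E' : Type*} [NormedAddCommGroup E'] [NormedSpace ℝ E']
  {N' : Type*} [TopologicalSpace N'] [ChartedSpace E' N']

variable (E E') in
/-- The differential of `f` at `p`, as a map between the model spaces. -/
def tangentMapAt (f : N → N') (p : N) : E →L[ℝ] E' :=
  mfderiv 𝓘(ℝ, E) 𝓘(ℝ, E') f p

/-- The curve `c` passes at time `0` through `p` with velocity `X`. -/
def HasVelocity (c : ℝ → N) (p : N) (X : E) : Prop :=
  c 0 = p ∧ HasMFDerivAt 𝓘(ℝ, ℝ) 𝓘(ℝ, E) c 0 (ContinuousLinearMap.toSpanSingleton ℝ X : ℝ →L[ℝ] E)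

theorem HasVelocity.unique {c : ℝ → N} {p q : N} {X Y : E} (h : HasVelocity c p X)
    (h' : HasVelocity c q Y) : X = Y := by
  have : (ContinuousLinearMap.toSpanSingleton ℝ X : ℝ →L[ℝ] E) =
      ContinuousLinearMap.toSpanSingleton ℝ Y := hasMFDerivAt_unique h.2 h'.2
  simpa using DFunLike.congr_fun this 1

theorem HasVelocity.congr {c c' : ℝ → N} {p : N} {X : E} (h : HasVelocity c p X)
    (h' : c' =ᶠ[𝓝 0] c) : HasVelocity c' p X :=
  ⟨h'.eq_of_nhds.trans h.1, h.2.congr_of_eventuallyEq h'⟩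

theorem hasVelocity_const (p : N) : HasVelocity (E := E) (fun _ : ℝ => p) p 0 := by
  refine ⟨rfl, ?_⟩
  have : (ContinuousLinearMap.toSpanSingleton ℝ (0 : E) : ℝ →L[ℝ] E) = 0 := by ext; simp
  rw [this]
  exact hasMFDerivAt_const p 0

theorem hasVelocity_line (p a : E) : HasVelocity (fun τ : ℝ => p + τ • a) p a := by
  refine ⟨by simp, HasFDerivAt.hasMFDerivAt ?_⟩
  have := ((hasDerivAt_id (0 : ℝ)).smul_const a).const_add p
  rw [one_smul] at this
  exact this.hasFDerivAt

theorem HasVelocity.comp {c : ℝ → N} {p : N} {X : E} {f : N → N'} (h : HasVelocity c p X)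
    (hf : MDifferentiableAt 𝓘(ℝ, E) 𝓘(ℝ, E') f p) :
    HasVelocity (fun τ => f (c τ)) (f p) (tangentMapAt E E' f p X) := by
  obtain ⟨rfl, h⟩ := h
  refine ⟨rfl, ?_⟩
  have := HasMFDerivAt.comp 0 hf.hasMFDerivAt h
  have h' : (tangentMapAt E E' f (c 0)).comp
      (ContinuousLinearMap.toSpanSingleton ℝ X : ℝ →L[ℝ] E) =
        ContinuousLinearMap.toSpanSingleton ℝ (tangentMapAt E E' f (c 0) X) := by
    ext
    simp
  rw [← h']
  exact this

/-- A chart identifies curves through a point with curves through its image: straight lines in the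
chart realize all velocities. -/
theorem exists_hasVelocity_chart_symm_line {φ : OpenPartialHomeomorph N E} [IsManifold 𝓘(ℝ, E) ∞ N]
    (hφ : φ ∈ IsManifold.maximalAtlas 𝓘(ℝ, E) ∞ N) {p : N} (hp : p ∈ φ.source) (X : E) :
    HasVelocity (fun τ : ℝ => φ.symm (φ p + τ • tangentMapAt E E φ p X)) p X := by
  have h1 : MDifferentiableAt 𝓘(ℝ, E) 𝓘(ℝ, E) φ p :=
    (contMDiffAt_of_mem_maximalAtlas hφ hp).mdifferentiableAt (by simp)
  have h2 : MDifferentiableAt 𝓘(ℝ, E) 𝓘(ℝ, E) φ.symm (φ p) :=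
    (contMDiffAt_symm_of_mem_maximalAtlas hφ (φ.map_source hp)).mdifferentiableAt (by simp)
  have h3 := (hasVelocity_line (φ p) (tangentMapAt E E φ p X)).comp h2
  rw [φ.left_inv hp] at h3
  convert h3 using 1
  have h4 := HasMFDerivAt.comp p h2.hasMFDerivAt h1.hasMFDerivAt
  have h5 := (hasMFDerivAt_id (I := 𝓘(ℝ, E)) p).congr_of_eventuallyEq
    (f₁ := φ.symm ∘ φ) (by
      filter_upwards [φ.open_source.mem_nhds hp] with q hq using φ.left_inv hq)
  exact (DFunLike.congr_fun (hasMFDerivAt_unique h4 h5) X).symm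

theorem exists_hasVelocity [IsManifold 𝓘(ℝ, E) ∞ N] (p : N) (X : E) :
    ∃ c : ℝ → N, HasVelocity c p X :=
  ⟨_, exists_hasVelocity_chart_symm_line (IsManifold.chart_mem_maximalAtlas p)
    (mem_chart_source E p) X⟩

/-- A line in the chart of the submersion normal form maps to a line in the chart of the base. -/
theorem Manifold.IsSubmersionAt.eventually_codChart_line {f : N → N'} {p : N}
    (h : Manifold.IsSubmersionAt 𝓘(ℝ, E) 𝓘(ℝ, E') ∞ f p) (a : E) :
    ∀ᶠ τ : ℝ in 𝓝 0, h.domChart.symm (h.domChart p + τ • a) ∈ h.domChart.source ∧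
      h.codChart (f (h.domChart.symm (h.domChart p + τ • a))) =
        h.codChart (f p) + τ • (h.equiv a).1 := by
  have hp := h.mem_domChart_source
  have hw : ∀ y ∈ h.domChart.target, h.codChart (f (h.domChart.symm y)) = (h.equiv y).1 := by
    intro y hy
    have hy' : y ∈ (h.domChart.extend 𝓘(ℝ, E)).target := by
      simpa [OpenPartialHomeomorph.extend] using hy
    simpa using h.writtenInCharts hy'
  have hc : ContinuousAt (fun τ : ℝ => h.domChart p + τ • a) 0 := by fun_prop
  have ht : h.domChart.target ∈ 𝓝 (h.domChart p + (0 : ℝ) • a) := by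
    simpa using h.domChart.open_target.mem_nhds (h.domChart.map_source hp)
  filter_upwards [hc.preimage_mem_nhds ht] with τ hτ
  refine ⟨h.domChart.map_target hτ, ?_⟩
  rw [hw _ hτ]
  have := hw _ (h.domChart.map_source hp)
  rw [h.domChart.left_inv hp] at this
  simp [this]

variable [IsManifold 𝓘(ℝ, E) ∞ N]

/-- In the normal form `f` is the first projection, hence so is its differential; both sides are
velocities of the image of one chart line. -/
theorem Manifold.IsSubmersionAt.equiv_tangentMapAt_fst {f : N → N'} {p : N}
    (h : Manifold.IsSubmersionAt 𝓘(ℝ, E) 𝓘(ℝ, E') ∞ f p) (X : E) :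
    (h.equiv (tangentMapAt E E h.domChart p X)).1 =
      tangentMapAt E' E' h.codChart (f p) (tangentMapAt E E' f p X) := by
  have h1 := exists_hasVelocity_chart_symm_line h.domChart_mem_maximalAtlas h.mem_domChart_source X
  have h2 := (h1.comp (h.contMDiffAt.mdifferentiableAt (by simp))).comp
    ((contMDiffAt_of_mem_maximalAtlas h.codChart_mem_maximalAtlas
      h.mem_codChart_source).mdifferentiableAt (by simp))
  refine ((hasVelocity_line (h.codChart (f p)) _).congr ?_).unique h2
  filter_upwards [h.eventually_codChart_line (tangentMapAt E E h.domChart p X)] with τ hτ using hτ.2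

theorem Manifold.IsSubmersionAt.exists_hasVelocity_fiber {f : N → N'} {p : N}
    (h : Manifold.IsSubmersionAt 𝓘(ℝ, E) 𝓘(ℝ, E') ∞ f p) {X : E} (hX : tangentMapAt E E' f p X = 0) :
    ∃ c : ℝ → N, HasVelocity c p X ∧ ∀ τ, f (c τ) = f p := by
  classical
  have h1 := exists_hasVelocity_chart_symm_line h.domChart_mem_maximalAtlas h.mem_domChart_source X
  have h2 := h.eventually_codChart_line (tangentMapAt E E h.domChart p X)
  rw [h.equiv_tangentMapAt_fst, hX] at h2
  set c : ℝ → N := fun τ => h.domChart.symm (h.domChart p + τ • tangentMapAt E E h.domChart p X)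
  -- The chart line stays in the fibre only for small `τ`; the constant value `p` elsewhere keeps
  -- the germ at `0` and makes the fibre condition global.
  refine ⟨fun τ => if f (c τ) = f p then c τ else p, h1.congr ?_, fun τ => ?_⟩
  · filter_upwards [h2] with τ hτ
    refine if_pos (h.codChart.injOn (h.source_subset_preimage_source hτ.1)
      h.mem_codChart_source ?_)
    simpa using hτ.2
  · dsimp only
    split_ifs with hτ
    exacts [hτ, rfl]

omit [IsManifold 𝓘(ℝ, E) ∞ N] in
variable [IsManifold 𝓘(ℝ, E') ∞ N'] in
theorem Manifold.IsSubmersionAt.tangentMapAt_surjective {f : N → N'} {p : N}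
    (h : Manifold.IsSubmersionAt 𝓘(ℝ, E) 𝓘(ℝ, E') ∞ f p) :
    Function.Surjective (tangentMapAt E E' f p : E → E') := by
  intro Z
  set a : E := h.equiv.symm (tangentMapAt E' E' h.codChart (f p) Z, 0) with ha
  have hp := h.mem_domChart_source
  have h2 : MDifferentiableAt 𝓘(ℝ, E) 𝓘(ℝ, E) h.domChart.symm (h.domChart p) :=
    (contMDiffAt_symm_of_mem_maximalAtlas h.domChart_mem_maximalAtlas
      (h.domChart.map_source hp)).mdifferentiableAt (by simp)
  have h3 := (hasVelocity_line (h.domChart p) a).comp h2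
  rw [h.domChart.left_inv hp] at h3
  refine ⟨_, (h3.comp (h.contMDiffAt.mdifferentiableAt (by simp))).unique
    ((exists_hasVelocity_chart_symm_line h.codChart_mem_maximalAtlas
      h.mem_codChart_source Z).congr ?_)⟩
  filter_upwards [h.eventually_codChart_line a] with τ hτ
  have hτ2 := hτ.2
  rw [ha, ContinuousLinearEquiv.apply_symm_apply, ← ha] at hτ2
  dsimp only at hτ2 ⊢
  rw [← hτ2, h.codChart.left_inv (h.source_subset_preimage_source hτ.1)]

end Velocity

/-! ### Alternating and multilinear algebra -/

section Multilinear

variable {V : Type*} [AddCommGroup V] [Module ℝ V]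

/-- A transposition brings argument `i` to the front; only vanishing matters, so the sign is
dropped. The last clause keeps track of the displaced head. -/
theorem AlternatingMap.exists_vecCons {r : ℕ} (η : V [⋀^Fin (r + 1)]→ₗ[ℝ] ℝ)
    (w : Fin (r + 1) → V) (i : Fin (r + 1)) :
    ∃ v : Fin r → V, (η (Matrix.vecCons (w i) v) = 0 → η w = 0) ∧ (i ≠ 0 → ∃ j, v j = w 0) := by
  rcases eq_or_ne i 0 with rfl | hi
  · exact ⟨Matrix.vecTail w, fun h => by rwa [← Matrix.cons_head_tail w], fun h => (h rfl).elim⟩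
  · obtain ⟨j, rfl⟩ := Fin.exists_succ_eq.2 hi
    refine ⟨Matrix.vecTail (w ∘ Equiv.swap 0 j.succ), fun h => ?_, fun _ => ⟨j, ?_⟩⟩
    · have h3 : Matrix.vecCons (w j.succ) (Matrix.vecTail (w ∘ Equiv.swap 0 j.succ)) =
          w ∘ Equiv.swap 0 j.succ := by
        conv_rhs => rw [← Matrix.cons_head_tail (w ∘ Equiv.swap 0 j.succ)]
        simp [Matrix.vecHead]
      rw [h3, η.map_swap w hi.symm] at h
      exact neg_eq_zero.1 h
    · simp [Matrix.vecTail]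

/-- A multilinear map that vanishes as soon as one argument lies in the kernel of a projection `P`
factors through `P`. -/
theorem MultilinearMap.map_projection {ι : Type*} [Fintype ι]
    (η : MultilinearMap ℝ (fun _ : ι => V) ℝ) (P : V → V) (hP : ∀ x, P (x - P x) = 0)
    (h : ∀ (v : ι → V) (i : ι), P (v i) = 0 → η v = 0) (v : ι → V) :
    η v = η fun i => P (v i) := by
  classical
  have hv : v = (fun i => P (v i)) + fun i => v i - P (v i) := by ext i; simp
  conv_lhs => rw [hv, η.map_add_univ]
  rw [Finset.sum_eq_single Finset.univ]
  · simp
  · intro s _ hs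
    obtain ⟨i, hi⟩ : ∃ i, i ∉ s := by
      by_contra! H
      exact hs (Finset.eq_univ_iff_forall.2 H)
    exact h _ i (by simp [hi, hP])
  · simp

/-- Allowing `X` in any slot treats all degrees alike: in degree `0` the right side is vacuous,
matching the convention. -/
theorem interiorProduct_eq_zero_iff [TopologicalSpace V] {r : ℕ} (X : V) (η : V [⋀^Fin r]→L[ℝ] ℝ) :
    interiorProduct X η = 0 ↔ ∀ (w : Fin r → V) (i : Fin r), w i = X → η w = 0 := by
  cases r with
  | zero => exact ⟨fun _ _ i => i.elim0, fun _ => rfl⟩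
  | succ r =>
    constructor
    · rintro h w i rfl
      obtain ⟨v, hv, -⟩ := η.toAlternatingMap.exists_vecCons w i
      exact hv (DFunLike.congr_fun h v)
    · intro h
      ext v
      exact h (Matrix.vecCons X v) 0 rfl

end Multilinear

namespace DifferentialForm

variable {E : Type*} [NormedAddCommGroup E] [NormedSpace ℝ E]
  {N : Type*} [TopologicalSpace N] [ChartedSpace E N] {r : ℕ}

/-- The value of a form at a point, as an alternating form on the model space. -/
def formAt (Ω : DifferentialForm E N r) (p : N) : E [⋀^Fin r]→L[ℝ] ℝ := Ω.toFun p

theorem isNondegenerate_iff (Ω : DifferentialForm E N r) :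
    Ω.IsNondegenerate ↔ ∀ (p : N) (X : E),
      (∀ (w : Fin r → E) (i : Fin r), w i = X → Ω.formAt p w = 0) → X = 0 :=
  forall_congr' fun _ => forall_congr' fun _ => imp_congr_left (interiorProduct_eq_zero_iff _ _)

end DifferentialForm

/-! ### Differentials of the groupoid structure maps -/

namespace LieGroupoid

variable {E F G M : Type*}
  [NormedAddCommGroup E] [NormedSpace ℝ E] [NormedAddCommGroup F] [NormedSpace ℝ F]
  [TopologicalSpace G] [ChartedSpace E G] [TopologicalSpace M] [ChartedSpace F M]
  (𝒢 : LieGroupoid E F G M)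

theorem inv_inv (g : G) : 𝒢.inv (𝒢.inv g) = g := by
  have h := 𝒢.mul_assoc (𝒢.inv (𝒢.inv g)) (𝒢.inv g) g (by rw [source_inv])
    (by rw [source_inv])
  rw [inv_mul, inv_mul, source_inv, unit_mul] at h
  have h2 := 𝒢.mul_unit (𝒢.inv (𝒢.inv g))
  rw [source_inv, target_inv] at h2
  exact (h.trans h2).symm

theorem mdifferentiable_source : MDifferentiable 𝓘(ℝ, E) 𝓘(ℝ, F) 𝒢.source :=
  𝒢.smooth_source.mdifferentiable (by simp)

theorem mdifferentiable_target : MDifferentiable 𝓘(ℝ, E) 𝓘(ℝ, F) 𝒢.target :=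
  𝒢.smooth_target.mdifferentiable (by simp)

theorem mdifferentiable_unit : MDifferentiable 𝓘(ℝ, F) 𝓘(ℝ, E) 𝒢.unit :=
  𝒢.smooth_unit.mdifferentiable (by simp)

theorem mdifferentiable_inv : MDifferentiable 𝓘(ℝ, E) 𝓘(ℝ, E) 𝒢.inv :=
  𝒢.smooth_inv.mdifferentiable (by simp)

/-- The differential of the multiplication, as a map between the model spaces. -/
def mulTangentMapAt (g h : G) : E × E →L[ℝ] E :=
  mfderivWithin (𝓘(ℝ, E).prod 𝓘(ℝ, E)) 𝓘(ℝ, E) (fun p : G × G => 𝒢.mul p.1 p.2)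
    𝒢.composable (g, h)

/-- The chain rule holds for any derivative within the composable pairs, so curves of composable
pairs compute `dm` without uniqueness of that derivative. -/
theorem hasVelocity_mul {c d : ℝ → G} {g h : G} {X Y : E} (hc : HasVelocity c g X)
    (hd : HasVelocity d h Y) (hcd : ∀ τ, 𝒢.source (c τ) = 𝒢.target (d τ)) :
    HasVelocity (fun τ => 𝒢.mul (c τ) (d τ)) (𝒢.mul g h) (𝒢.mulTangentMapAt g h (X, Y)) := by
  obtain ⟨rfl, hc⟩ := hc
  obtain ⟨rfl, hd⟩ := hd
  refine ⟨rfl, ?_⟩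
  have hm := ((𝒢.smooth_mul (c 0, d 0) (hcd 0)).mdifferentiableWithinAt
    (by simp)).hasMFDerivWithinAt
  have := HasMFDerivWithinAt.comp 0 hm (hc.prodMk hd).hasMFDerivWithinAt
    (s := Set.univ) (u := 𝒢.composable) (fun τ _ => hcd τ)
  rw [hasMFDerivWithinAt_univ] at this
  have h' : (𝒢.mulTangentMapAt (c 0) (d 0)).comp
      ((ContinuousLinearMap.toSpanSingleton ℝ X : ℝ →L[ℝ] E).prod
        (ContinuousLinearMap.toSpanSingleton ℝ Y)) =
      ContinuousLinearMap.toSpanSingleton ℝ (𝒢.mulTangentMapAt (c 0) (d 0) (X, Y)) := by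
    ext
    simp
  rw [← h']
  exact this

/-- The tangent vector `Z` at `p` is the product, in the tangent groupoid, of `X` at `g` and `Y` at
`h`. -/
def IsTangentProduct (g h p : G) (X Y Z : E) : Prop :=
  ∃ c d : ℝ → G, HasVelocity c g X ∧ HasVelocity d h Y ∧
    (∀ τ, 𝒢.source (c τ) = 𝒢.target (d τ)) ∧ HasVelocity (fun τ => 𝒢.mul (c τ) (d τ)) p Z

variable {𝒢}

theorem IsTangentProduct.source_eq_target {g h p : G} {X Y Z : E}
    (H : 𝒢.IsTangentProduct g h p X Y Z) : 𝒢.source g = 𝒢.target h := by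
  obtain ⟨c, d, hc, hd, hcd, -⟩ := H
  rw [← hc.1, ← hd.1, hcd]

theorem IsTangentProduct.mul_eq {g h p : G} {X Y Z : E}
    (H : 𝒢.IsTangentProduct g h p X Y Z) : 𝒢.mul g h = p := by
  obtain ⟨c, d, hc, hd, hcd, hm⟩ := H
  rw [← hc.1, ← hd.1, ← hm.1]

theorem IsTangentProduct.mulTangentMapAt_eq {g h p : G} {X Y Z : E}
    (H : 𝒢.IsTangentProduct g h p X Y Z) : 𝒢.mulTangentMapAt g h (X, Y) = Z := by
  obtain ⟨c, d, hc, hd, hcd, hm⟩ := H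
  exact (𝒢.hasVelocity_mul hc hd hcd).unique hm

theorem IsTangentProduct.tangentMapAt_source_eq {g h p : G} {X Y Z : E}
    (H : 𝒢.IsTangentProduct g h p X Y Z) :
    tangentMapAt E F 𝒢.source g X = tangentMapAt E F 𝒢.target h Y := by
  obtain ⟨c, d, hc, hd, hcd, hm⟩ := H
  refine (hc.comp (𝒢.mdifferentiable_source g)).unique
    ((hd.comp (𝒢.mdifferentiable_target h)).congr (.of_forall hcd))

theorem IsTangentProduct.tangentMapAt_target_eq {g h p : G} {X Y Z : E}
    (H : 𝒢.IsTangentProduct g h p X Y Z) :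
    tangentMapAt E F 𝒢.target p Z = tangentMapAt E F 𝒢.target g X := by
  obtain ⟨c, d, hc, hd, hcd, hm⟩ := H
  exact (hm.comp (𝒢.mdifferentiable_target p)).unique
    ((hc.comp (𝒢.mdifferentiable_target g)).congr (.of_forall fun τ => 𝒢.target_mul _ _ (hcd τ)))

theorem IsTangentProduct.eq_zero {g h p : G} {Z : E}
    (H : 𝒢.IsTangentProduct g h p 0 0 Z) : Z = 0 := by
  rw [← H.mulTangentMapAt_eq]
  exact map_zero _

theorem IsMultiplicative.formAt_eq_add {r : ℕ} {Ω : DifferentialForm E G (r + 1)}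
    (hΩ : 𝒢.IsMultiplicative Ω) {g h p : G} {X Y Z : Fin (r + 1) → E}
    (H : ∀ i, 𝒢.IsTangentProduct g h p (X i) (Y i) (Z i)) :
    Ω.formAt p Z = Ω.formAt g X + Ω.formAt h Y := by
  obtain rfl := (H 0).mul_eq
  refine Eq.trans (congrArg (Ω.formAt _) (funext fun i => (H i).mulTangentMapAt_eq.symm)) ?_
  exact hΩ g h (H 0).source_eq_target X Y fun i => (H i).tangentMapAt_source_eq

theorem IsMultiplicative.formAt_vecCons_eq_add {r : ℕ} {Ω : DifferentialForm E G (r + 1)}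
    (hΩ : 𝒢.IsMultiplicative Ω) {g h p : G} {x y z : E} {X Y Z : Fin r → E}
    (h₀ : 𝒢.IsTangentProduct g h p x y z)
    (H : ∀ i, 𝒢.IsTangentProduct g h p (X i) (Y i) (Z i)) :
    Ω.formAt p (Matrix.vecCons z Z) =
      Ω.formAt g (Matrix.vecCons x X) + Ω.formAt h (Matrix.vecCons y Y) :=
  hΩ.formAt_eq_add (Fin.cases h₀ H)

variable (𝒢) in
theorem tangentMapAt_source_unit (x : M) (X : F) [IsManifold 𝓘(ℝ, F) ∞ M] :
    tangentMapAt E F 𝒢.source (𝒢.unit x) (tangentMapAt F E 𝒢.unit x X) = X := by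
  obtain ⟨c, hc⟩ := exists_hasVelocity x X
  exact ((hc.comp (𝒢.mdifferentiable_unit x)).comp (𝒢.mdifferentiable_source _)).unique
    (hc.congr (.of_forall fun τ => 𝒢.source_unit _))

variable (𝒢) in
theorem tangentMapAt_target_unit (x : M) (X : F) [IsManifold 𝓘(ℝ, F) ∞ M] :
    tangentMapAt E F 𝒢.target (𝒢.unit x) (tangentMapAt F E 𝒢.unit x X) = X := by
  obtain ⟨c, hc⟩ := exists_hasVelocity x X
  exact ((hc.comp (𝒢.mdifferentiable_unit x)).comp (𝒢.mdifferentiable_target _)).unique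
    (hc.congr (.of_forall fun τ => 𝒢.target_unit _))

variable (𝒢) in
theorem tangentMapAt_source_inv [IsManifold 𝓘(ℝ, E) ∞ G] (g : G) (X : E) :
    tangentMapAt E F 𝒢.source (𝒢.inv g) (tangentMapAt E E 𝒢.inv g X) =
      tangentMapAt E F 𝒢.target g X := by
  obtain ⟨c, hc⟩ := exists_hasVelocity g X
  exact ((hc.comp (𝒢.mdifferentiable_inv g)).comp (𝒢.mdifferentiable_source _)).unique
    ((hc.comp (𝒢.mdifferentiable_target g)).congr (.of_forall fun τ => 𝒢.source_inv _))

variable (𝒢) in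
theorem tangentMapAt_inv_inv [IsManifold 𝓘(ℝ, E) ∞ G] (g : G) (X : E) :
    tangentMapAt E E 𝒢.inv (𝒢.inv g) (tangentMapAt E E 𝒢.inv g X) = X := by
  obtain ⟨c, hc⟩ := exists_hasVelocity g X
  exact ((hc.comp (𝒢.mdifferentiable_inv g)).comp (𝒢.mdifferentiable_inv _)).unique
    (hc.congr (.of_forall fun τ => 𝒢.inv_inv _))

variable (𝒢) in
theorem tangentMapAt_source_surjective [IsManifold 𝓘(ℝ, F) ∞ M] (g : G) :
    Function.Surjective (tangentMapAt E F 𝒢.source g) :=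
  (𝒢.source_submersion.isSubmersionAt g).tangentMapAt_surjective

variable (𝒢) in
-- Inversion exchanges source and target, so the submersion property transfers.
theorem tangentMapAt_target_surjective [IsManifold 𝓘(ℝ, E) ∞ G] [IsManifold 𝓘(ℝ, F) ∞ M] (g : G) :
    Function.Surjective (tangentMapAt E F 𝒢.target g) := by
  intro Z
  obtain ⟨Y, rfl⟩ := 𝒢.tangentMapAt_source_surjective (𝒢.inv g) Z
  refine ⟨tangentMapAt E E 𝒢.inv (𝒢.inv g) Y, ?_⟩
  have h := 𝒢.tangentMapAt_source_inv g (tangentMapAt E E 𝒢.inv (𝒢.inv g) Y)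
  have h' := 𝒢.tangentMapAt_inv_inv (𝒢.inv g) Y
  rw [𝒢.inv_inv] at h'
  rw [← h, h']

variable (𝒢) in
theorem exists_hasVelocity_target_fiber [IsManifold 𝓘(ℝ, E) ∞ G] {g : G} {X : E}
    (hX : tangentMapAt E F 𝒢.target g X = 0) :
    ∃ c : ℝ → G, HasVelocity c g X ∧ ∀ τ, 𝒢.target (c τ) = 𝒢.target g := by
  rw [← tangentMapAt_source_inv] at hX
  obtain ⟨c, hc, hcs⟩ := (𝒢.source_submersion.isSubmersionAt _).exists_hasVelocity_fiber hX
  refine ⟨fun τ => 𝒢.inv (c τ), ?_, fun τ => ?_⟩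
  · have := hc.comp (𝒢.mdifferentiable_inv _)
    rwa [𝒢.tangentMapAt_inv_inv, 𝒢.inv_inv] at this
  · rw [𝒢.target_inv, hcs, 𝒢.source_inv]

/-! ### Products and translations in the tangent groupoid -/

section TangentGroupoid

variable (𝒢)

theorem isTangentProduct_unit [IsManifold 𝓘(ℝ, F) ∞ M] (x : M) (X : F) :
    𝒢.IsTangentProduct (𝒢.unit x) (𝒢.unit x) (𝒢.unit x) (tangentMapAt F E 𝒢.unit x X)
      (tangentMapAt F E 𝒢.unit x X) (tangentMapAt F E 𝒢.unit x X) := by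
  obtain ⟨c, hc⟩ := exists_hasVelocity x X
  have h := hc.comp (𝒢.mdifferentiable_unit x)
  refine ⟨_, _, h, h, fun τ => by rw [source_unit, target_unit],
    h.congr (.of_forall fun τ => ?_)⟩
  simpa only [source_unit] using 𝒢.mul_unit (𝒢.unit (c τ))

variable [IsManifold 𝓘(ℝ, E) ∞ G]

theorem isTangentProduct_unit_left (g : G) (Y : E) :
    𝒢.IsTangentProduct (𝒢.unit (𝒢.target g)) g g
      (tangentMapAt F E 𝒢.unit (𝒢.target g) (tangentMapAt E F 𝒢.target g Y)) Y Y := by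
  obtain ⟨c, hc⟩ := exists_hasVelocity g Y
  exact ⟨_, c, (hc.comp (𝒢.mdifferentiable_target g)).comp (𝒢.mdifferentiable_unit _), hc,
    fun τ => 𝒢.source_unit _, hc.congr (.of_forall fun τ => 𝒢.unit_mul _)⟩

theorem isTangentProduct_inv_left (g : G) (Y : E) :
    𝒢.IsTangentProduct (𝒢.inv g) g (𝒢.unit (𝒢.source g)) (tangentMapAt E E 𝒢.inv g Y) Y
      (tangentMapAt F E 𝒢.unit (𝒢.source g) (tangentMapAt E F 𝒢.source g Y)) := by
  obtain ⟨c, hc⟩ := exists_hasVelocity g Y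
  exact ⟨_, c, hc.comp (𝒢.mdifferentiable_inv g), hc, fun τ => 𝒢.source_inv _,
    ((hc.comp (𝒢.mdifferentiable_source g)).comp (𝒢.mdifferentiable_unit _)).congr
      (.of_forall fun τ => 𝒢.inv_mul _)⟩

theorem exists_isTangentProduct_zero_right {g h : G} (hgh : 𝒢.source g = 𝒢.target h) {u : E}
    (hu : tangentMapAt E F 𝒢.source g u = 0) :
    ∃ Z, 𝒢.IsTangentProduct g h (𝒢.mul g h) u 0 Z := by
  obtain ⟨c, hc, hcs⟩ := (𝒢.source_submersion.isSubmersionAt _).exists_hasVelocity_fiber hu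
  have hcd : ∀ τ, 𝒢.source (c τ) = 𝒢.target h := fun τ => (hcs τ).trans hgh
  exact ⟨_, c, fun _ => h, hc, hasVelocity_const h, hcd,
    𝒢.hasVelocity_mul hc (hasVelocity_const h) hcd⟩

theorem isTangentProduct_zero_unit_right {g : G} {u : E}
    (hu : tangentMapAt E F 𝒢.source g u = 0) :
    𝒢.IsTangentProduct g (𝒢.unit (𝒢.source g)) g u 0 u := by
  obtain ⟨c, hc, hcs⟩ := (𝒢.source_submersion.isSubmersionAt _).exists_hasVelocity_fiber hu
  refine ⟨c, fun _ => 𝒢.unit (𝒢.source g), hc, hasVelocity_const _,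
    fun τ => by rw [hcs, target_unit], hc.congr (.of_forall fun τ => ?_)⟩
  dsimp only
  rw [← hcs τ, mul_unit]

/-- Left translation by `g⁻¹` of a vector tangent to a target fibre. -/
theorem exists_isTangentProduct_zero_left {g : G} {X : E}
    (hX : tangentMapAt E F 𝒢.target g X = 0) :
    ∃ v, 𝒢.IsTangentProduct (𝒢.inv g) g (𝒢.unit (𝒢.source g)) 0 X v ∧
      𝒢.IsTangentProduct g (𝒢.unit (𝒢.source g)) g 0 v X := by
  obtain ⟨c, hc, hct⟩ := 𝒢.exists_hasVelocity_target_fiber hX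
  have hcd : ∀ τ, 𝒢.source (𝒢.inv g) = 𝒢.target (c τ) := fun τ => by rw [hct, source_inv]
  have hm := 𝒢.hasVelocity_mul (hasVelocity_const (𝒢.inv g)) hc hcd
  rw [𝒢.inv_mul] at hm
  refine ⟨_, ⟨fun _ => 𝒢.inv g, c, hasVelocity_const _, hc, hcd, hm⟩,
    ⟨fun _ => g, _, hasVelocity_const _, hm, fun τ => ?_, hc.congr (.of_forall fun τ => ?_)⟩⟩
  · rw [𝒢.target_mul _ _ (hcd τ), target_inv]
  · dsimp only
    rw [← 𝒢.mul_assoc _ _ _ (𝒢.target_inv g).symm (hcd τ), 𝒢.mul_inv, ← hct τ, 𝒢.unit_mul]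

end TangentGroupoid

/-! ### Multiplicative forms and the two implications -/

section MultiplicativeForms

variable {k : ℕ} {Ω : DifferentialForm E G (k + 1)}

variable (𝒢 Ω) in
/-- The value `μ(u)(w₁, …, w_k)` of the IM form, for a vector `u` of the model space of `G`. -/
def imValue (x : M) (u : E) (w : Fin k → F) : ℝ :=
  Ω.formAt (𝒢.unit x) (Matrix.vecCons u fun i => tangentMapAt F E 𝒢.unit x (w i))

/-- The restriction of a multiplicative form to the units vanishes. -/
theorem IsMultiplicative.formAt_unit_eq_zero [IsManifold 𝓘(ℝ, F) ∞ M]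
    (hΩ : 𝒢.IsMultiplicative Ω) (x : M) (w : Fin (k + 1) → F) :
    Ω.formAt (𝒢.unit x) (fun i => tangentMapAt F E 𝒢.unit x (w i)) = 0 :=
  -- Since `dε(w)·dε(w) = dε(w)`, the value `a` satisfies `a = a + a`.
  left_eq_add.1 (hΩ.formAt_eq_add fun i => 𝒢.isTangentProduct_unit x (w i))

theorem vecCons_zero_eq_zero {r : ℕ} (η : E [⋀^Fin (r + 1)]→L[ℝ] ℝ) (w : Fin r → E) :
    η (Matrix.vecCons 0 w) = 0 :=
  η.map_coord_zero 0 rfl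

/-- `i_Z Ω = t^* μ(u)`, where `Z` is the right translate to `g` of `u ∈ A`. -/
theorem IsMultiplicative.formAt_rightTranslate [IsManifold 𝓘(ℝ, E) ∞ G]
    (hΩ : 𝒢.IsMultiplicative Ω) {g : G} {u Z : E}
    (hZ : 𝒢.IsTangentProduct (𝒢.unit (𝒢.target g)) g g u 0 Z) (w : Fin k → E) :
    Ω.formAt g (Matrix.vecCons Z w) =
      𝒢.imValue Ω (𝒢.target g) u fun i => tangentMapAt E F 𝒢.target g (w i) := by
  rw [hΩ.formAt_vecCons_eq_add hZ fun i => 𝒢.isTangentProduct_unit_left g (w i),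
    vecCons_zero_eq_zero, add_zero, imValue]

/-- At a unit, `u·0 = u`: the vector `u` is its own right translate. -/
theorem IsMultiplicative.formAt_unit [IsManifold 𝓘(ℝ, E) ∞ G]
    (hΩ : 𝒢.IsMultiplicative Ω) {x : M} {u : E}
    (hu : tangentMapAt E F 𝒢.source (𝒢.unit x) u = 0) (w : Fin k → E) :
    Ω.formAt (𝒢.unit x) (Matrix.vecCons u w) =
      𝒢.imValue Ω x u fun i => tangentMapAt E F 𝒢.target (𝒢.unit x) (w i) := by
  have h := 𝒢.isTangentProduct_zero_unit_right hu
  have h' := fun i => 𝒢.isTangentProduct_unit_left (𝒢.unit x) (w i)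
  rw [source_unit] at h
  simp only [target_unit] at h'
  rw [hΩ.formAt_vecCons_eq_add h h', vecCons_zero_eq_zero, add_zero, imValue]

theorem IsMultiplicative.eq_zero_of_imValue_eq_zero_of_isNondegenerate [IsManifold 𝓘(ℝ, E) ∞ G]
    (hΩ : 𝒢.IsMultiplicative Ω) (hnd : Ω.IsNondegenerate) {x : M}
    {u : E} (hu : tangentMapAt E F 𝒢.source (𝒢.unit x) u = 0)
    (hμ : ∀ w : Fin k → F, 𝒢.imValue Ω x u w = 0) : u = 0 := by
  refine hnd (𝒢.unit x) u ?_
  ext w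
  exact (hΩ.formAt_unit hu w).trans (hμ _)

variable [IsManifold 𝓘(ℝ, E) ∞ G] [IsManifold 𝓘(ℝ, F) ∞ M]

theorem IsMultiplicative.annihilator_eq_zero_of_isNondegenerate
    (hΩ : 𝒢.IsMultiplicative Ω) (hnd : Ω.IsNondegenerate) {x : M} {X : F}
    (hX : ∀ u : E, tangentMapAt E F 𝒢.source (𝒢.unit x) u = 0 →
      ∀ (w : Fin k → F) (i : Fin k), w i = X → 𝒢.imValue Ω x u w = 0) : X = 0 := by
  set X' : E := tangentMapAt F E 𝒢.unit x X with hX'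
  by_cases hX0 : X' = 0
  · rw [← 𝒢.tangentMapAt_source_unit x X, ← hX', hX0, map_zero]
  refine (hX0 (hnd (𝒢.unit x) X' ?_)).elim
  ext w
  change (Ω.formAt (𝒢.unit x)).toAlternatingMap.curryLeft X' w = 0
  -- The projection `dε ∘ ds` has kernel `A_x` and image `T_xM`, so it suffices to treat one
  -- argument in `A_x` and all arguments in `T_xM`.
  refine (MultilinearMap.map_projection
    ((Ω.formAt (𝒢.unit x)).toAlternatingMap.curryLeft X').toMultilinearMap
    (fun Y => tangentMapAt F E 𝒢.unit x (tangentMapAt E F 𝒢.source (𝒢.unit x) Y)) ?_ ?_ w).trans ?_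
  · intro Y
    simp only [map_sub, 𝒢.tangentMapAt_source_unit, sub_self, map_zero]
  · intro v i hv
    have hu : tangentMapAt E F 𝒢.source (𝒢.unit x) (v i) = 0 := by
      rw [← 𝒢.tangentMapAt_source_unit x (tangentMapAt E F 𝒢.source (𝒢.unit x) (v i)), hv, map_zero]
    change (Ω.formAt (𝒢.unit x)).toAlternatingMap (Matrix.vecCons X' v) = 0
    obtain ⟨w', hw', hj⟩ := (Ω.formAt (𝒢.unit x)).toAlternatingMap.exists_vecCons
      (Matrix.vecCons X' v) i.succ
    obtain ⟨j, hj⟩ := hj (Fin.succ_ne_zero i)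
    refine hw' ((hΩ.formAt_unit hu w').trans (hX _ hu _ j ?_))
    rw [hj, Matrix.cons_val_zero, hX', 𝒢.tangentMapAt_target_unit]
  · have := hΩ.formAt_unit_eq_zero x
      (Matrix.vecCons X fun i => tangentMapAt E F 𝒢.source (𝒢.unit x) (w i))
    refine Eq.trans (congrArg (Ω.formAt (𝒢.unit x)) ?_) this
    ext i
    cases i using Fin.cases <;> rfl

theorem IsMultiplicative.eq_zero_of_ker_eq_bot_of_annihilator
    (hΩ : 𝒢.IsMultiplicative Ω) 
    (hker : ∀ (x : M) (u : E), tangentMapAt E F 𝒢.source (𝒢.unit x) u = 0 →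
      (∀ w : Fin k → F, 𝒢.imValue Ω x u w = 0) → u = 0)
    (hann : ∀ (x : M) (X : F), (∀ u : E, tangentMapAt E F 𝒢.source (𝒢.unit x) u = 0 →
      ∀ (w : Fin k → F) (i : Fin k), w i = X → 𝒢.imValue Ω x u w = 0) → X = 0) {g : G} {X : E}
    (hX : ∀ (w : Fin (k + 1) → E) (i : Fin (k + 1)), w i = X → Ω.formAt g w = 0) : X = 0 := by
  have ht : tangentMapAt E F 𝒢.target g X = 0 := by
    refine hann (𝒢.target g) _ fun u hu w i hi => ?_
    obtain ⟨Z, hZ⟩ := 𝒢.exists_isTangentProduct_zero_right (𝒢.source_unit (𝒢.target g)) hu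
    rw [𝒢.unit_mul] at hZ
    choose Y hY using fun j => 𝒢.tangentMapAt_target_surjective g (w j)
    -- Lift the `w j` through `dt`, using `X` itself as the lift of `w i = dt X`; the left side then
    -- contains `X` and vanishes.
    have h := hΩ.formAt_rightTranslate hZ (Function.update Y i X)
    rw [hX _ i.succ (by simp)] at h
    rw [h]
    congr 1
    ext j
    rcases eq_or_ne j i with rfl | hj
    · simp [hi]
    · simp [hj, hY]
  obtain ⟨v, hv, hv'⟩ := 𝒢.exists_isTangentProduct_zero_left ht
  set x := 𝒢.source g
  have hvt : tangentMapAt E F 𝒢.target (𝒢.unit x) v = 0 := by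
    rw [hv.tangentMapAt_target_eq, map_zero]
  have hvΩ : ∀ w : Fin k → F,
      Ω.formAt (𝒢.unit x) (Matrix.vecCons v fun i => tangentMapAt F E 𝒢.unit x (w i)) = 0 := by
    intro w
    choose Y hY using fun j => 𝒢.tangentMapAt_source_surjective g (w j)
    -- Factor `v = 0·X` and `dε(ds Y) = Y⁻¹·Y`: one summand has a zero argument, the other contains
    -- `X`.
    have h := hΩ.formAt_vecCons_eq_add hv fun i => 𝒢.isTangentProduct_inv_left g (Y i)
    simp only [hY] at h
    rw [h, vecCons_zero_eq_zero, hX _ 0 rfl, add_zero]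
  set a : F := tangentMapAt E F 𝒢.source (𝒢.unit x) v
  have hu : v - tangentMapAt F E 𝒢.unit x a = 0 := by
    refine hker x _ (by rw [map_sub, 𝒢.tangentMapAt_source_unit, sub_self]) fun w => ?_
    have h1 := hvΩ w
    have h2 := hΩ.formAt_unit_eq_zero x (Matrix.vecCons a w)
    have h3 := ((Ω.formAt (𝒢.unit x)).toAlternatingMap.curryLeft.map_sub v
      (tangentMapAt F E 𝒢.unit x a))
    have h4 := DFunLike.congr_fun h3 fun i => tangentMapAt F E 𝒢.unit x (w i)
    refine h4.trans ((congrArg₂ (· - ·) h1 (Eq.trans (congrArg (Ω.formAt (𝒢.unit x)) ?_) h2)).trans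
      (sub_zero 0))
    ext i
    cases i using Fin.cases <;> rfl
  have hva : v = tangentMapAt F E 𝒢.unit x a := sub_eq_zero.1 hu
  rw [hva, 𝒢.tangentMapAt_target_unit] at hvt
  rw [hvt, map_zero] at hva
  rw [hva] at hv'
  -- Translating back, `X = 0·v` with `v = 0`.
  exact hv'.eq_zero

end MultiplicativeForms

end LieGroupoid

/-! ### The nondegeneracy criterion -/

theorem mainTheorem1 {E F G M : Type*}
    [NormedAddCommGroup E] [NormedSpace ℝ E] [FiniteDimensional ℝ E]
    [NormedAddCommGroup F] [NormedSpace ℝ F] [FiniteDimensional ℝ F]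
    [TopologicalSpace G] [ChartedSpace E G] [IsManifold 𝓘(ℝ, E) ∞ G]
    [TopologicalSpace M] [ChartedSpace F M] [IsManifold 𝓘(ℝ, F) ∞ M]
    (𝒢 : LieGroupoid E F G M) (hs : 𝒢.IsSourceSimplyConnected)
    {k : ℕ} (Ω : DifferentialForm E G (k + 1))
    (hclosed : Ω.IsClosed) (hmult : 𝒢.IsMultiplicative Ω) :
    Ω.IsNondegenerate ↔
      (∀ x : M, LinearMap.ker (𝒢.imForm Ω x) = ⊥) ∧
      (∀ x : M, {X : TangentSpace 𝓘(ℝ, F) x |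
        ∀ u : 𝒢.algebroidFiber x, interiorProduct X (𝒢.imForm Ω x u) = 0} = {0}) := by
  have hker : (∀ x : M, LinearMap.ker (𝒢.imForm Ω x) = ⊥) ↔
      ∀ (x : M) (u : E), tangentMapAt E F 𝒢.source (𝒢.unit x) u = 0 →
        (∀ w : Fin k → F, 𝒢.imValue Ω x u w = 0) → u = 0 := by
    refine forall_congr' fun x => (Submodule.eq_bot_iff _).trans
      ⟨fun h u hu hw => ?_, fun h u hu => ?_⟩
    · exact congrArg Subtype.val (h ⟨u, hu⟩ (ContinuousAlternatingMap.ext hw))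
    · exact Subtype.ext (h u.1 u.2 fun w => DFunLike.congr_fun (LinearMap.mem_ker.1 hu) w)
  have hann : (∀ x : M, {X : TangentSpace 𝓘(ℝ, F) x |
        ∀ u : 𝒢.algebroidFiber x, interiorProduct X (𝒢.imForm Ω x u) = 0} = {0}) ↔
      ∀ (x : M) (X : F), (∀ u : E, tangentMapAt E F 𝒢.source (𝒢.unit x) u = 0 →
        ∀ (w : Fin k → F) (i : Fin k), w i = X → 𝒢.imValue Ω x u w = 0) → X = 0 := by
    refine forall_congr' fun x => ⟨fun h X hX => ?_, fun h => ?_⟩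
    · exact (Set.ext_iff.1 h X).1 fun u => (interiorProduct_eq_zero_iff _ _).2 (hX u.1 u.2)
    · refine Set.Subset.antisymm
        (fun X hX => h X fun u hu => (interiorProduct_eq_zero_iff _ _).1 (hX ⟨u, hu⟩)) ?_
      rintro _ rfl u
      exact (interiorProduct_eq_zero_iff _ _).2 fun w i hi => (𝒢.imForm Ω x u).map_coord_zero i hi
  rw [hker, hann]
  exact ⟨fun h => ⟨fun x u => hmult.eq_zero_of_imValue_eq_zero_of_isNondegenerate h,
    fun x X => hmult.annihilator_eq_zero_of_isNondegenerate h⟩, fun h =>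
      Ω.isNondegenerate_iff.2 fun p X => hmult.eq_zero_of_ker_eq_bot_of_annihilator h.1 h.2⟩

end
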